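/- Let $H=\frac1{\sqrt2}\begin{pmatrix}1&1\\1&-1\end{pmatrix}$ be the Hadamard gate on one qubit and let $\Lambda^2(\sigma^x)$ be the Toffoli gate on three qubits, which applies $\sigma^x=\begin{pmatrix}0&1\\1&0\end{pmatrix}$ to the last qubit if the first two qubits are both $1$ and is the identity otherwise. For a set $G$ of real gates (real orthogonal operators on a positive number of qubits) and $n\ge1$, the subgroup of $O(2^n)$ generated by $G$ is the one generated by all operators $g[A]$, where $g\in G$ and $g[A]$ denotes $g$ applied to an ordered subset $A$ of the $n$ qubits (and the identity on the other qubits). The set $G$ is called complete if it generates a dense subgroup of $O(k)$ for some $k=2^n\ge2$. Theorem. The set $\{\Lambda^2(\sigma^x),H\}$ is complete. More precisely, on three qubits it generates a subgroup $\Gamma$ that is dense in $O(8)$, and $\Gamma\cap SO(8)$ is dense in $SO(8)$. -/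

import Mathlib

namespace QGate

/-- Labels `b₁ b₂ … bₙ` of the computational basis vectors of `n` qubits. -/
abbrev Bits (n : ℕ) : Type := Fin n → Fin 2

/-- A real gate: a real orthogonal operator on `arity > 0` qubits, written in the computational
basis. -/
structure RealGate where
  /-- the number of qubits -/
  arity : ℕ
  arity_pos : 0 < arity
  /-- the operator -/
  op : Matrix.orthogonalGroup (Bits arity) ℝ

/-- The matrix of `U[A]`: the operator `U` on `r` qubits applied to the qubits
`A 0, …, A (r - 1)` (in this order) of an `n`-qubit system, the identity on the others. -/
def applyOn {r n : ℕ} (U : Matrix (Bits r) (Bits r) ℝ) (A : Fin r ↪ Fin n) :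
    Matrix (Bits n) (Bits n) ℝ :=
  open Classical in
  Matrix.of fun x y =>
    if ∀ i : Fin n, i ∉ Set.range A → x i = y i then U (x ∘ A) (y ∘ A) else 0

theorem applyOn_mem {r n : ℕ} {U : Matrix (Bits r) (Bits r) ℝ}
    (hU : U ∈ Matrix.orthogonalGroup (Bits r) ℝ) (A : Fin r ↪ Fin n) :
    applyOn U A ∈ Matrix.orthogonalGroup (Bits n) ℝ := by
  classical
  rw [Matrix.mem_orthogonalGroup_iff] at hU ⊢
  ext x z
  rw [Matrix.mul_apply]
  simp only [Matrix.transpose_apply, applyOn, Matrix.of_apply]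
  by_cases hxz : ∀ i : Fin n, i ∉ Set.range A → x i = z i
  · have key : ∑ w : Bits r, U (x ∘ A) w * U (z ∘ A) w =
        ∑ y : Bits n, (if ∀ i : Fin n, i ∉ Set.range A → x i = y i
            then U (x ∘ A) (y ∘ A) else 0) *
          (if ∀ i : Fin n, i ∉ Set.range A → z i = y i
            then U (z ∘ A) (y ∘ A) else 0) := by
      refine Finset.sum_of_injOn (fun w => Function.extend A w x) ?_ ?_ ?_ ?_
      · intro w _ w' _ h
        funext j
        have := congrFun h (A j)
        simpa [A.injective.extend_apply] using this
      · intro w _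
        simp
      · intro y _ hy
        rw [if_neg, zero_mul]
        intro h
        apply hy
        refine ⟨y ∘ A, by simp, ?_⟩
        funext i
        by_cases hi : i ∈ Set.range A
        · obtain ⟨j, rfl⟩ := hi
          simp [A.injective.extend_apply]
        · show Function.extend A (y ∘ A) x i = y i
          rw [Function.extend_apply' _ _ _ hi, h i hi]
      · intro w _
        have e : Function.extend A w x ∘ A = w := by
          funext j
          simp [A.injective.extend_apply]
        rw [if_pos, if_pos, e]
        · intro i hi
          rw [Function.extend_apply' _ _ _ hi, hxz i hi]
        · intro i hi
          rw [Function.extend_apply' _ _ _ hi]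
    rw [← key]
    have h2 := congrFun (congrFun hU (x ∘ A)) (z ∘ A)
    rw [Matrix.mul_apply] at h2
    simp only [Matrix.transpose_apply] at h2
    rw [h2, Matrix.one_apply, Matrix.one_apply]
    congr 1
    refine propext ⟨fun h => ?_, fun h => by rw [h]⟩
    funext i
    by_cases hi : i ∈ Set.range A
    · obtain ⟨j, rfl⟩ := hi
      exact congrFun h j
    · exact hxz i hi
  · rw [Matrix.one_apply_ne (fun h => hxz (fun i _ => by rw [h]))]
    refine Finset.sum_eq_zero fun y _ => ?_
    by_cases h1 : ∀ i : Fin n, i ∉ Set.range A → x i = y i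
    · rw [if_neg (c := ∀ i : Fin n, i ∉ Set.range A → z i = y i), mul_zero]
      exact fun h3 => hxz fun i hi => (h1 i hi).trans (h3 i hi).symm
    · rw [if_neg h1, zero_mul]

/-- The gate `g` applied to an ordered subset `A` of `n` qubits, as an orthogonal operator. -/
def RealGate.on {n : ℕ} (g : RealGate) (A : Fin g.arity ↪ Fin n) :
    Matrix.orthogonalGroup (Bits n) ℝ :=
  ⟨applyOn g.op.1 A, applyOn_mem g.op.2 A⟩

/-- The subgroup of `O(2ⁿ)` generated by the set of gates `G` acting on `n` qubits. -/
def generated (G : Set RealGate) (n : ℕ) : Subgroup (Matrix.orthogonalGroup (Bits n) ℝ) :=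
  Subgroup.closure {V | ∃ g ∈ G, ∃ A : Fin g.arity ↪ Fin n, V = g.on A}

/-- A set of real gates is complete if it generates a dense subgroup of `O(k)`, where `k = 2ⁿ ≥ 2`
is the dimension of the state space of some number `n ≥ 1` of qubits. -/
def IsComplete (G : Set RealGate) : Prop :=
  ∃ n : ℕ, 1 ≤ n ∧ Dense (generated G n : Set (Matrix.orthogonalGroup (Bits n) ℝ))

/-- The Pauli operator `σˣ`. -/
def sigmaX : Matrix (Fin 2) (Fin 2) ℝ := !![0, 1; 1, 0]

/-- The Hadamard matrix. -/
noncomputable def hadamardMatrix : Matrix (Fin 2) (Fin 2) ℝ :=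
  (1 / Real.sqrt 2) • !![1, 1; 1, -1]

/-- The matrix of `Λ²(σˣ)`: it applies `σˣ` to the last qubit if the first two are both `1`, and
is the identity otherwise. -/
def toffoliMatrix : Matrix (Bits 3) (Bits 3) ℝ :=
  Matrix.of fun x y =>
    if x 0 = y 0 ∧ x 1 = y 1 then
      (if y 0 = 1 ∧ y 1 = 1 then sigmaX (x 2) (y 2)
        else (1 : Matrix (Fin 2) (Fin 2) ℝ) (x 2) (y 2))
    else 0

theorem hadamard_mem :
    (Matrix.of fun x y : Bits 1 => hadamardMatrix (x 0) (y 0)) ∈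
      Matrix.orthogonalGroup (Bits 1) ℝ := by
  rw [Matrix.mem_orthogonalGroup_iff]
  have hs : (Real.sqrt 2)⁻¹ * (Real.sqrt 2)⁻¹ = 1 / 2 := by
    rw [← mul_inv, Real.mul_self_sqrt (by norm_num)]
    norm_num
  have hH : hadamardMatrix * hadamardMatrix.transpose = 1 := by
    ext i j
    fin_cases i <;> fin_cases j <;>
      simp [hadamardMatrix, Matrix.mul_apply, Fin.sum_univ_two, hs] <;> norm_num
  ext x z
  rw [Matrix.mul_apply, ← (Equiv.funUnique (Fin 1) (Fin 2)).symm.sum_comp]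
  have h := congrFun (congrFun hH (x 0)) (z 0)
  rw [Matrix.mul_apply] at h
  have e : (x 0 = z 0) = (x = z) :=
    propext ⟨fun h => funext fun i => by rw [Subsingleton.elim i 0, h], fun h => by rw [h]⟩
  rw [Matrix.one_apply] at h ⊢
  simp only [e] at h
  exact h

theorem toffoli_mem : toffoliMatrix ∈ Matrix.orthogonalGroup (Bits 3) ℝ := by
  rw [Matrix.mem_orthogonalGroup_iff]
  have key : ∀ x z : Bits 3, ∑ y : Bits 3,
      (if x 0 = y 0 ∧ x 1 = y 1 ∧ ((y 0 = 1 ∧ y 1 = 1) ↔ x 2 ≠ y 2) then 1 else 0 : ℕ) *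
      (if z 0 = y 0 ∧ z 1 = y 1 ∧ ((y 0 = 1 ∧ y 1 = 1) ↔ z 2 ≠ y 2) then 1 else 0 : ℕ) =
      if x = z then 1 else 0 := by
    decide
  have entry : ∀ x y : Bits 3, toffoliMatrix x y =
      ((if x 0 = y 0 ∧ x 1 = y 1 ∧ ((y 0 = 1 ∧ y 1 = 1) ↔ x 2 ≠ y 2) then 1 else 0 : ℕ) : ℝ) := by
    intro x y
    have hX : ∀ a b : Fin 2, sigmaX a b = if a ≠ b then 1 else 0 := by
      intro a b
      fin_cases a <;> fin_cases b <;> simp [sigmaX]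
    simp only [toffoliMatrix, Matrix.of_apply, hX, Matrix.one_apply]
    by_cases h1 : x 0 = y 0 ∧ x 1 = y 1
    · by_cases h2 : y 0 = 1 ∧ y 1 = 1
      · simp [h1, h2]
      · by_cases h3 : x 2 = y 2 <;> simp [h1, h2, h3]
    · rw [if_neg h1, if_neg (fun h => h1 ⟨h.1, h.2.1⟩), Nat.cast_zero]
  ext x z
  rw [Matrix.mul_apply]
  simp only [Matrix.transpose_apply, entry]
  have h := congrArg (Nat.cast : ℕ → ℝ) (key x z)
  rw [Matrix.one_apply]
  rw [Nat.cast_sum] at h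
  simp only [Nat.cast_mul] at h
  rw [h]
  split_ifs <;> simp

/-- The Hadamard gate. -/
noncomputable def hadamard : RealGate where
  arity := 1
  arity_pos := by norm_num
  op := ⟨Matrix.of fun x y => hadamardMatrix (x 0) (y 0), hadamard_mem⟩

/-- The Toffoli gate. -/
def toffoli : RealGate where
  arity := 3
  arity_pos := by norm_num
  op := ⟨toffoliMatrix, toffoli_mem⟩

end QGate

/-! Let `K` be the closure of the generated group and call `v` a member if `K` contains the
reflection in `v^⊥`. Members form a closed set, stable under scaling, under `K`, and hence under
their own reflections. The Toffoli gate is itself a reflection, and Hadamard gates carry its vector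
to others, in particular to multiples of `|111⟩` and of its image under all three Hadamards.

These two meet at cosine `-1/√8`, by Niven's theorem not a rational angle, so their reflections are
dense among those of a plane and the whole plane consists of members (`span_pair_mem`). A subspace
of members of dimension at least two absorbs every member not orthogonal to it
(`sup_span_singleton_mem`): almost all of its vectors near the projection plane make an irrational
angle with the new one. A maximal such subspace `W` therefore contains every member not orthogonal
to `|111⟩`, and these span everything (`reflectionVectors_eq_univ`). By Cartan–Dieudonné, `K` is all
of `O(8)`. Density in `SO(8)` follows because the determinant-one part is open in the orthogonal
group. -/

open scoped RealInnerProductSpace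

/-! ### Sets of directions closed under their own reflections -/

/-- A closed set of directions in a real inner product space that is stable under scaling and under
the reflections in the hyperplanes orthogonal to its own members. -/
structure IsReflectionClosed {E : Type*} [NormedAddCommGroup E] [InnerProductSpace ℝ E]
    (Φ : Set E) : Prop where
  isClosed : IsClosed Φ
  smul_mem : ∀ (a : ℝ) {v : E}, v ∈ Φ → a • v ∈ Φ
  reflect_mem : ∀ {u v : E}, u ∈ Φ → ‖u‖ = 1 → v ∈ Φ → v - (2 * ⟪u, v⟫) • u ∈ Φ

/-- The cosines of the rational multiples of `π`. -/
def rationalAngleCosines : Set ℝ := Set.range fun r : ℚ => Real.cos (r * Real.pi)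

theorem rationalAngleCosines_countable : rationalAngleCosines.Countable :=
  Set.countable_range _

theorem one_mem_rationalAngleCosines : (1 : ℝ) ∈ rationalAngleCosines :=
  ⟨0, by simp⟩

theorem neg_one_mem_rationalAngleCosines : (-1 : ℝ) ∈ rationalAngleCosines :=
  ⟨1, by simp⟩

/-- A closed set of reals containing `0`, stable under `t ↦ t + π` and under the point reflections
in `0` and `θ`, is everything when `θ` is not a rational multiple of `π`. -/
theorem eq_univ_of_isClosed_of_irrational {T : Set ℝ} {θ : ℝ} (hT : IsClosed T) (h0 : 0 ∈ T)
    (hpi : ∀ t ∈ T, t + Real.pi ∈ T) (hneg : ∀ t ∈ T, -t ∈ T) (hθ : ∀ t ∈ T, 2 * θ - t ∈ T)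
    (hirr : Irrational (θ / Real.pi)) : T = Set.univ := by
  -- The translations preserving `T`. The reflections in `0` and `θ` compose to translation by `2 *
  -- θ`, which with `π` generates a dense group.
  let A : AddSubgroup ℝ :=
    { carrier := {a | ∀ t ∈ T, t + a ∈ T}
      zero_mem' := fun t ht => by simpa using ht
      add_mem' := fun {a b} ha hb t ht => by
        rw [← add_assoc]
        exact hb _ (ha _ ht)
      neg_mem' := fun {a} ha t ht => by
        have h := hneg _ (ha _ (hneg _ ht))
        rwa [neg_add, neg_neg] at h }
  have hle : AddSubgroup.closure {2 * θ, Real.pi} ≤ A := by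
    rw [AddSubgroup.closure_le]
    rintro x (rfl | rfl)
    · intro t ht
      have h := hθ _ (hneg _ ht)
      rwa [sub_neg_eq_add, add_comm] at h
    · exact hpi
  have hdense : Dense (AddSubgroup.closure {2 * θ, Real.pi} : Set ℝ) := by
    rw [dense_addSubgroupClosure_pair_iff, mul_div_assoc]
    exact_mod_cast hirr.ratCast_mul (q := 2) two_ne_zero
  have hsub : (AddSubgroup.closure {2 * θ, Real.pi} : Set ℝ) ⊆ T := fun x hx => by
    simpa using hle hx 0 h0
  exact Set.eq_univ_of_univ_subset (hdense.closure_eq ▸ closure_minimal hsub hT)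

theorem exists_polar (a b : ℝ) : ∃ r t : ℝ, r * Real.cos t = a ∧ r * Real.sin t = b :=
  ⟨‖(⟨a, b⟩ : ℂ)‖, Complex.arg ⟨a, b⟩, Complex.norm_mul_cos_arg _, Complex.norm_mul_sin_arg _⟩

namespace IsReflectionClosed

variable {E : Type*} [NormedAddCommGroup E] [InnerProductSpace ℝ E] {Φ : Set E}

theorem neg_mem (hΦ : IsReflectionClosed Φ) {v : E} (hv : v ∈ Φ) : -v ∈ Φ := by
  simpa using hΦ.smul_mem (-1) hv

theorem mem_of_smul_mem (hΦ : IsReflectionClosed Φ) {a : ℝ} (ha : a ≠ 0) {v : E}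
    (hv : a • v ∈ Φ) : v ∈ Φ := by
  simpa [smul_smul, ha] using hΦ.smul_mem a⁻¹ hv

/-- Two members at an angle that is not a rational multiple of `π` span a plane of members. -/
theorem span_pair_mem (hΦ : IsReflectionClosed Φ) {u v : E} (hu : u ∈ Φ) (hv : v ∈ Φ)
    (hu1 : ‖u‖ = 1) (hv1 : ‖v‖ = 1) (huv : ⟪u, v⟫ ∉ rationalAngleCosines) (a b : ℝ) :
    a • u + b • v ∈ Φ := by
  have hle : |⟪u, v⟫| ≤ 1 := by simpa [hu1, hv1] using abs_real_inner_le_norm u v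
  set θ := Real.arccos ⟪u, v⟫ with hθ
  have hcos : Real.cos θ = ⟪u, v⟫ := Real.cos_arccos (abs_le.1 hle).1 (abs_le.1 hle).2
  have hirr : Irrational (θ / Real.pi) := by
    rintro ⟨r, hr⟩
    refine huv ⟨r, ?_⟩
    simp only [hr, ← hcos, div_mul_cancel₀ _ Real.pi_ne_zero]
  have hsin : Real.sin θ ≠ 0 := by
    intro h
    rcases Real.sin_eq_zero_iff_cos_eq.1 h with h | h
    · exact huv (hcos ▸ h ▸ one_mem_rationalAngleCosines)
    · exact huv (hcos ▸ h ▸ neg_one_mem_rationalAngleCosines)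
  -- `y t` is `sin θ` times the unit vector at angle `t` from `u` towards `v`, so `y 0` and `y θ`
  -- are multiples of `u` and `v`.
  let y : ℝ → E := fun t => Real.sin (θ - t) • u + Real.sin t • v
  have hyinner : ∀ s t, ⟪y s, y t⟫ = Real.sin θ ^ 2 * Real.cos (s - t) := by
    intro s t
    simp only [y, inner_add_left, inner_add_right, real_inner_smul_left, real_inner_smul_right,
      real_inner_self_eq_norm_sq, hu1, hv1, real_inner_comm u v, ← hcos, Real.sin_sub,
      Real.cos_sub]
    linear_combination (-Real.sin s * Real.sin t) * Real.sin_sq_add_cos_sq θ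
  -- Minus the reflection in `(y s)^⊥` fixes the line of `y s`, hence acts on angles as the point
  -- reflection in `s`.
  have hreflect : ∀ s t, y s ∈ Φ → y t ∈ Φ → y (2 * s - t) ∈ Φ := by
    intro s t hs ht
    have hnorm : ‖(Real.sin θ)⁻¹ • y s‖ = 1 := by
      have h : ‖(Real.sin θ)⁻¹ • y s‖ ^ 2 = 1 := by
        rw [← real_inner_self_eq_norm_sq, real_inner_smul_left, real_inner_smul_right, hyinner]
        simp only [sub_self, Real.cos_zero]
        field_simp
      exact (pow_eq_one_iff_of_nonneg (norm_nonneg _) two_ne_zero).1 h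
    have h := hΦ.neg_mem (hΦ.reflect_mem (hΦ.smul_mem (Real.sin θ)⁻¹ hs) hnorm ht)
    convert h using 1
    have hc : 2 * ⟪(Real.sin θ)⁻¹ • y s, y t⟫ * (Real.sin θ)⁻¹ = 2 * Real.cos (s - t) := by
      rw [real_inner_smul_left, hyinner]
      field_simp
    rw [smul_smul, hc]
    simp only [y]
    have h1 : Real.sin (θ - (2 * s - t)) =
        2 * Real.cos (s - t) * Real.sin (θ - s) - Real.sin (θ - t) := by
      rw [show θ - (2 * s - t) = (θ - s) - (s - t) by ring,
        show θ - t = (θ - s) + (s - t) by ring, Real.sin_sub, Real.sin_add]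
      ring
    have h2 : Real.sin (2 * s - t) = 2 * Real.cos (s - t) * Real.sin s - Real.sin t := by
      rw [show 2 * s - t = s + (s - t) by ring, show Real.sin t = Real.sin (s - (s - t)) by ring_nf,
        Real.sin_sub s (s - t), Real.sin_add]
      ring
    rw [h1, h2]
    module
  have hycont : Continuous y := by fun_prop
  have hy0 : y 0 ∈ Φ := by simpa [y] using hΦ.smul_mem (Real.sin θ) hu
  have hyθ : y θ ∈ Φ := by simpa [y] using hΦ.smul_mem (Real.sin θ) hv
  have hT : y ⁻¹' Φ = Set.univ := by
    refine eq_univ_of_isClosed_of_irrational (θ := θ) (hΦ.isClosed.preimage hycont) hy0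
      ?_ ?_ ?_ hirr
    · intro t ht
      have h : y (t + Real.pi) = -y t := by
        simp only [y, Real.sin_add_pi, show θ - (t + Real.pi) = θ - t - Real.pi by ring,
          Real.sin_sub_pi]
        module
      rw [Set.mem_preimage, h]
      exact hΦ.neg_mem ht
    · intro t ht
      simpa using hreflect 0 t hy0 ht
    · intro t ht
      exact hreflect θ t hyθ ht
  -- Polar form of the solution of `r * sin (θ - t) = a`, `r * sin t = b`.
  obtain ⟨r, t, hr, ht⟩ := exists_polar ((a + b * Real.cos θ) / Real.sin θ) b
  have hyt : y t ∈ Φ := by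
    have : t ∈ y ⁻¹' Φ := hT ▸ Set.mem_univ t
    exact this
  have h := hΦ.smul_mem r hyt
  convert h using 1
  simp only [y, smul_add, smul_smul, ht]
  congr 2
  rw [Real.sin_sub]
  field_simp at hr
  linear_combination -hr + Real.cos θ * ht

/-- `span_pair_mem` without normalization. -/
theorem span_pair_mem' (hΦ : IsReflectionClosed Φ) {u v : E} (hu : u ∈ Φ) (hv : v ∈ Φ)
    (hu0 : u ≠ 0) (hv0 : v ≠ 0) (huv : ⟪u, v⟫ / (‖u‖ * ‖v‖) ∉ rationalAngleCosines) (a b : ℝ) :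
    a • u + b • v ∈ Φ := by
  have hu' := norm_ne_zero_iff.2 hu0
  have hv' := norm_ne_zero_iff.2 hv0
  have h := hΦ.span_pair_mem (hΦ.smul_mem ‖u‖⁻¹ hu) (hΦ.smul_mem ‖v‖⁻¹ hv)
    (by simp [norm_smul, hu']) (by simp [norm_smul, hv'])
    (by
      convert huv using 1
      rw [real_inner_smul_left, real_inner_smul_right]
      field_simp) (a * ‖u‖) (b * ‖v‖)
  simpa [smul_smul, mul_assoc, hu', hv'] using h

/-- If `p` is the orthogonal projection of `v` to the plane spanned by `p` and `q`, and all vectors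
of this plane as well as `v` are members, then so are all combinations of the three. -/
theorem combination_mem (hΦ : IsReflectionClosed Φ) {v p q : E} (hv : v ∈ Φ)
    (hpq : ∀ b d : ℝ, b • p + d • q ∈ Φ) (hp0 : p ≠ 0) (hq0 : q ≠ 0) (hq : ⟪p, q⟫ = 0)
    (hvp : ⟪v, p⟫ = ‖p‖ ^ 2) (hvq : ⟪v, q⟫ = 0) (a b d : ℝ) :
    a • v + b • p + d • q ∈ Φ := by
  have hp' := norm_pos_iff.2 hp0
  have hq' := norm_pos_iff.2 hq0
  have hv0 : v ≠ 0 := by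
    rintro rfl
    simp only [inner_zero_left] at hvp
    exact (pow_pos hp' 2).ne hvp
  have hv' := norm_pos_iff.2 hv0
  have hin : ∀ s : ℝ, ⟪v, s • p + q⟫ = s * ‖p‖ ^ 2 := fun s => by
    rw [inner_add_right, real_inner_smul_right, hvp, hvq, add_zero]
  have hsq : ∀ s : ℝ, ‖s • p + q‖ ^ 2 = s ^ 2 * ‖p‖ ^ 2 + ‖q‖ ^ 2 := fun s => by
    rw [norm_add_sq_real, real_inner_smul_left, hq, norm_smul, mul_pow, Real.norm_eq_abs, sq_abs]
    ring
  have hpos : ∀ s : ℝ, 0 < ‖s • p + q‖ := fun s => by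
    have h : 0 < ‖s • p + q‖ ^ 2 := by rw [hsq]; positivity
    exact (norm_nonneg _).lt_of_ne fun h0 => by simp [← h0] at h
  -- The cosine of the angle between `v` and `s • p + q`. It is injective in `s`, so only countably
  -- many `s` give a rational angle; closedness recovers those.
  let g : ℝ → ℝ := fun s => ⟪v, s • p + q⟫ / (‖v‖ * ‖s • p + q‖)
  have hginj : Function.Injective g := by
    intro s s' h
    have h1 : s * ‖s' • p + q‖ = s' * ‖s • p + q‖ := by
      have hs := (hpos s).ne'
      have hs' := (hpos s').ne'
      simp only [g, hin] at h
      field_simp at h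
      linear_combination h
    have h2 : s ^ 2 = s' ^ 2 := by
      have h3 : s ^ 2 * ‖s' • p + q‖ ^ 2 = s' ^ 2 * ‖s • p + q‖ ^ 2 := by
        rw [← mul_pow, h1, mul_pow]
      rw [hsq, hsq] at h3
      have h4 : (s ^ 2 - s' ^ 2) * ‖q‖ ^ 2 = 0 := by linear_combination h3
      rcases mul_eq_zero.1 h4 with h5 | h5
      · linarith
      · exact absurd h5 (pow_pos hq' 2).ne'
    have h6 : ‖s • p + q‖ = ‖s' • p + q‖ := by
      rw [← sq_eq_sq₀ (norm_nonneg _) (norm_nonneg _), hsq, hsq, h2]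
    rw [h6] at h1
    exact mul_right_cancel₀ (hpos s').ne' h1
  have hs : ∀ s a d : ℝ, a • v + d • (s • p + q) ∈ Φ := by
    intro s a d
    have hclosed : IsClosed {s : ℝ | a • v + d • (s • p + q) ∈ Φ} :=
      hΦ.isClosed.preimage (f := fun s : ℝ => a • v + d • (s • p + q)) (by fun_prop)
    have hdense : Dense (g ⁻¹' rationalAngleCosines)ᶜ :=
      (rationalAngleCosines_countable.preimage hginj).dense_compl ℝ
    have hsub : (g ⁻¹' rationalAngleCosines)ᶜ ⊆ {s : ℝ | a • v + d • (s • p + q) ∈ Φ} :=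
      fun s hs => hΦ.span_pair_mem' hv (by simpa using hpq s 1) hv0 (norm_pos_iff.1 (hpos s)) hs a d
    exact closure_minimal hsub hclosed (hdense s)
  have hclosed : IsClosed {d : ℝ | a • v + b • p + d • q ∈ Φ} :=
    hΦ.isClosed.preimage (f := fun d : ℝ => a • v + b • p + d • q) (by fun_prop)
  -- For `d ≠ 0` take slope `s = b / d`; the case `d = 0` is a limit.
  have hsub : ({0}ᶜ : Set ℝ) ⊆ {d : ℝ | a • v + b • p + d • q ∈ Φ} := by
    intro d hd
    have hd' : d ≠ 0 := hd
    have h := hs (b / d) a d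
    rwa [smul_add, smul_smul, mul_div_cancel₀ _ hd', ← add_assoc] at h
  exact closure_minimal hsub hclosed (dense_compl_singleton 0 d)

/-- A subspace of members that is not a line can be enlarged by any member not orthogonal to it. -/
theorem sup_span_singleton_mem (hΦ : IsReflectionClosed Φ) [FiniteDimensional ℝ E]
    {W : Submodule ℝ E} (hW : (W : Set E) ⊆ Φ) (hline : ∀ p : E, ¬ W ≤ Submodule.span ℝ {p})
    {v : E} (hv : v ∈ Φ) (hvW : v ∉ Wᗮ) :
    ((W ⊔ Submodule.span ℝ {v} : Submodule ℝ E) : Set E) ⊆ Φ := by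
  set p := W.starProjection v with hp
  have hpW : p ∈ W := W.starProjection_apply_mem v
  have hinner : ∀ w ∈ W, ⟪v, w⟫ = ⟪p, w⟫ := by
    intro w hw
    have h := W.starProjection_inner_eq_zero v w hw
    rw [inner_sub_left] at h
    linarith
  have hp0 : p ≠ 0 := by
    intro h
    apply hvW
    rw [Submodule.mem_orthogonal']
    intro w hw
    rw [hinner w hw, h, inner_zero_left]
  have hpp : ⟪p, p⟫ ≠ 0 := inner_self_ne_zero.2 hp0
  have hvp : ⟪v, p⟫ = ‖p‖ ^ 2 := by rw [hinner p hpW, real_inner_self_eq_norm_sq]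
  have horth : ∀ w, ⟪p, w - (⟪p, w⟫ / ⟪p, p⟫) • p⟫ = 0 := by
    intro w
    rw [inner_sub_right, real_inner_smul_right, div_mul_cancel₀ _ hpp, sub_self]
  have hcomb : ∀ q ∈ W, q ≠ 0 → ⟪p, q⟫ = 0 → ∀ a b d : ℝ, a • v + b • p + d • q ∈ Φ := by
    intro q hqW hq0 hq
    exact hΦ.combination_mem hv
      (fun b d => hW (W.add_mem (W.smul_mem b hpW) (W.smul_mem d hqW))) hp0 hq0 hq hvp
      (by rw [hinner q hqW, hq])
  intro x hx
  obtain ⟨w, hw, z, hz, rfl⟩ := Submodule.mem_sup.1 hx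
  obtain ⟨a, rfl⟩ := Submodule.mem_span_singleton.1 hz
  -- If `w` is parallel to `p`, it supplies no second direction `q`; another vector of `W`, which is
  -- not a line, supplies it and enters with coefficient `0`.
  by_cases hq : w - (⟪p, w⟫ / ⟪p, p⟫) • p = 0
  · obtain ⟨w', hw', hw'p⟩ := SetLike.not_le_iff_exists.1 (hline p)
    have h := hcomb (w' - (⟪p, w'⟫ / ⟪p, p⟫) • p) (W.sub_mem hw' (W.smul_mem _ hpW))
      (fun h => hw'p (Submodule.mem_span_singleton.2 ⟨_, (sub_eq_zero.1 h).symm⟩)) (horth w')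
      a (⟪p, w⟫ / ⟪p, p⟫) 0
    rwa [zero_smul, add_zero, ← sub_eq_zero.1 hq, add_comm] at h
  · have h := hcomb _ (W.sub_mem hw (W.smul_mem _ hpW)) hq (horth w) a (⟪p, w⟫ / ⟪p, p⟫) 1
    convert h using 1
    module

/-- Two members at an angle that is not a rational multiple of `π` lie in a subspace of members to
which every other member either belongs or is orthogonal. -/
theorem exists_submodule (hΦ : IsReflectionClosed Φ) [FiniteDimensional ℝ E] {u v : E}
    (hu : u ∈ Φ) (hv : v ∈ Φ) (hu1 : ‖u‖ = 1) (hv1 : ‖v‖ = 1)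
    (huv : ⟪u, v⟫ ∉ rationalAngleCosines) :
    ∃ W : Submodule ℝ E, u ∈ W ∧ v ∈ W ∧ (W : Set E) ⊆ Φ ∧ ∀ x ∈ Φ, x ∈ W ∨ x ∈ Wᗮ := by
  have hne : ({W : Submodule ℝ E | u ∈ W ∧ v ∈ W ∧ (W : Set E) ⊆ Φ}).Nonempty := by
    refine ⟨Submodule.span ℝ {u, v}, Submodule.subset_span (by simp),
      Submodule.subset_span (by simp), ?_⟩
    intro x hx
    obtain ⟨a, b, rfl⟩ := Submodule.mem_span_pair.1 hx
    exact hΦ.span_pair_mem hu hv hu1 hv1 huv a b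
  obtain ⟨W, ⟨huW, hvW, hW⟩, hmax⟩ :=
    set_has_maximal_iff_noetherian.2 (inferInstance : IsNoetherian ℝ E) _ hne
  refine ⟨W, huW, hvW, hW, fun x hx => ?_⟩
  by_contra! hxW
  -- Unit vectors on a common line have inner product `±1`, the cosine of a rational angle.
  have hline : ∀ p : E, ¬ W ≤ Submodule.span ℝ {p} := by
    intro p hp
    obtain ⟨a, rfl⟩ := Submodule.mem_span_singleton.1 (hp huW)
    obtain ⟨b, rfl⟩ := Submodule.mem_span_singleton.1 (hp hvW)
    rw [norm_smul, Real.norm_eq_abs] at hu1 hv1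
    have h : |⟪a • p, b • p⟫| = 1 := by
      rw [real_inner_smul_left, real_inner_smul_right, real_inner_self_eq_norm_sq, abs_mul, abs_mul,
        abs_of_nonneg (sq_nonneg ‖p‖)]
      linear_combination |b| * ‖p‖ * hu1 + hv1
    rcases eq_or_eq_neg_of_abs_eq h with h | h
    · exact huv (h ▸ one_mem_rationalAngleCosines)
    · exact huv (h ▸ neg_one_mem_rationalAngleCosines)
  have hlt : W < W ⊔ Submodule.span ℝ {x} := by
    refine lt_of_le_of_ne le_sup_left fun h => hxW.1 ?_
    rw [h]
    exact Submodule.mem_sup_right (Submodule.mem_span_singleton_self x)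
  exact hmax _ ⟨hlt.le huW, hlt.le hvW, hΦ.sup_span_singleton_mem hW hline hx hxW.2⟩ hlt

end IsReflectionClosed

/-! ### Reflections in a group of orthogonal matrices -/

/-- Real orthogonal matrices are the linear isometries of Euclidean space. -/
noncomputable def orthogonalGroupEquiv (ι : Type*) [Fintype ι] [DecidableEq ι] :
    Matrix.orthogonalGroup ι ℝ ≃* (EuclideanSpace ℝ ι ≃ₗᵢ[ℝ] EuclideanSpace ℝ ι) :=
  (Unitary.mapEquiv 
    { (Matrix.toEuclideanCLM (𝕜 := ℝ) (n := ι)) with }).toMulEquiv.trans Unitary.linearIsometryEquiv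

theorem orthogonalGroupEquiv_apply {ι : Type*} [Fintype ι] [DecidableEq ι]
    (M : Matrix.orthogonalGroup ι ℝ) (x : EuclideanSpace ℝ ι) :
    orthogonalGroupEquiv ι M x = WithLp.toLp 2 (M.1.mulVec x.ofLp) := rfl

theorem orthogonalGroupEquiv_symm_apply {ι : Type*} [Fintype ι] [DecidableEq ι]
    (f : EuclideanSpace ℝ ι ≃ₗᵢ[ℝ] EuclideanSpace ℝ ι) (i j : ι) :
    ((orthogonalGroupEquiv ι).symm f).1 i j = f (EuclideanSpace.single j 1) i := by
  obtain ⟨M, rfl⟩ := (orthogonalGroupEquiv ι).surjective f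
  rw [MulEquiv.symm_apply_apply, orthogonalGroupEquiv_apply]
  simp

theorem reflection_span_singleton_orthogonal_apply {E : Type*} [NormedAddCommGroup E]
    [InnerProductSpace ℝ E] (u v : E) :
    (ℝ ∙ u)ᗮ.reflection v = v - (2 * (⟪u, v⟫ / ‖u‖ ^ 2)) • u := by
  rw [Submodule.reflection_orthogonal_apply, Submodule.reflection_singleton_apply]
  simp only [RCLike.ofReal_real_eq_id, id]
  module

/-- The vectors `v` such that the group `K` contains the reflection in the hyperplane `v^⊥`. -/
def reflectionVectors {ι : Type*} [Fintype ι] [DecidableEq ι]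
    (K : Subgroup (Matrix.orthogonalGroup ι ℝ)) : Set (EuclideanSpace ℝ ι) :=
  {v | (orthogonalGroupEquiv ι).symm (ℝ ∙ v)ᗮ.reflection ∈ K}

section

variable {ι : Type*} [Fintype ι] [DecidableEq ι] {K : Subgroup (Matrix.orthogonalGroup ι ℝ)}

theorem zero_mem_reflectionVectors : (0 : EuclideanSpace ℝ ι) ∈ reflectionVectors K := by
  have h : (ℝ ∙ (0 : EuclideanSpace ℝ ι))ᗮ.reflection = 1 := by
    ext1 x
    rw [reflection_span_singleton_orthogonal_apply]
    simp
  rw [reflectionVectors, Set.mem_ofPred_eq, h, map_one]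
  exact K.one_mem

theorem smul_mem_reflectionVectors (a : ℝ) {v : EuclideanSpace ℝ ι}
    (hv : v ∈ reflectionVectors K) : a • v ∈ reflectionVectors K := by
  rcases eq_or_ne a 0 with rfl | ha
  · rw [zero_smul]
    exact zero_mem_reflectionVectors
  · have h : (ℝ ∙ (a • v)) = ℝ ∙ v := Submodule.span_singleton_smul_eq (IsUnit.mk0 a ha) v
    simp only [reflectionVectors, Set.mem_ofPred_eq, h]
    exact hv

/-- The group permutes its reflection vectors. -/
theorem map_mem_reflectionVectors {M : Matrix.orthogonalGroup ι ℝ} (hM : M ∈ K)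
    {v : EuclideanSpace ℝ ι} (hv : v ∈ reflectionVectors K) :
    orthogonalGroupEquiv ι M v ∈ reflectionVectors K := by
  set f := orthogonalGroupEquiv ι M with hf
  -- Conjugating a reflection by an isometry moves its normal vector.
  have h : (ℝ ∙ f v)ᗮ.reflection = f * (ℝ ∙ v)ᗮ.reflection * f⁻¹ := by
    ext1 x
    obtain ⟨y, rfl⟩ := f.surjective x
    have hy : (f * (ℝ ∙ v)ᗮ.reflection * f⁻¹) (f y) = f ((ℝ ∙ v)ᗮ.reflection y) :=
      congrArg (fun z => f ((ℝ ∙ v)ᗮ.reflection z)) (f.symm_apply_apply y)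
    rw [hy, reflection_span_singleton_orthogonal_apply, reflection_span_singleton_orthogonal_apply,
      map_sub, map_smul, f.inner_map_map, f.norm_map]
  rw [reflectionVectors, Set.mem_ofPred_eq, h, map_mul, map_mul, map_inv, hf,
    MulEquiv.symm_apply_apply]
  exact K.mul_mem (K.mul_mem hM hv) (K.inv_mem hM)

/-- The reflection depends continuously on its normal vector away from `0`, and `0` is always a
member because it gives the identity. -/
theorem isClosed_reflectionVectors (hK : IsClosed (K : Set (Matrix.orthogonalGroup ι ℝ))) :
    IsClosed (reflectionVectors K) := by
  refine isClosed_of_closure_subset fun v hv => ?_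
  rcases eq_or_ne v 0 with rfl | hv0
  · exact zero_mem_reflectionVectors
  have hcont : ContinuousAt
      (fun u : EuclideanSpace ℝ ι => (orthogonalGroupEquiv ι).symm (ℝ ∙ u)ᗮ.reflection) v := by
    rw [Topology.IsInducing.subtypeVal.continuousAt_iff]
    refine continuousAt_pi.2 fun i => continuousAt_pi.2 fun j => ?_
    have he : (fun u : EuclideanSpace ℝ ι =>
        ((orthogonalGroupEquiv ι).symm (ℝ ∙ u)ᗮ.reflection).1 i j) = fun u =>
        (EuclideanSpace.single j (1 : ℝ) : EuclideanSpace ℝ ι) i -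
          2 * (⟪u, EuclideanSpace.single j 1⟫ / ‖u‖ ^ 2) * u i := by
      funext u
      rw [orthogonalGroupEquiv_symm_apply, reflection_span_singleton_orthogonal_apply]
      rfl
    change ContinuousAt (fun u : EuclideanSpace ℝ ι =>
        ((orthogonalGroupEquiv ι).symm (ℝ ∙ u)ᗮ.reflection).1 i j) v
    rw [he]
    have hn : ‖v‖ ^ 2 ≠ 0 := pow_ne_zero 2 (norm_ne_zero_iff.2 hv0)
    fun_prop (disch := assumption)
  exact hK.closure_subset_iff.2 (Set.image_subset_iff.2 fun u hu => hu)
    (hcont.continuousWithinAt.mem_closure_image hv)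

theorem isReflectionClosed_reflectionVectors
    (hK : IsClosed (K : Set (Matrix.orthogonalGroup ι ℝ))) :
    IsReflectionClosed (reflectionVectors K) where
  isClosed := isClosed_reflectionVectors hK
  smul_mem a _ hv := smul_mem_reflectionVectors a hv
  reflect_mem {u v} hu hu1 hv := by
    have h := map_mem_reflectionVectors hu hv
    rwa [MulEquiv.apply_symm_apply, reflection_span_singleton_orthogonal_apply, hu1, one_pow,
      div_one] at h

/-- A group of orthogonal matrices containing all reflections is the whole orthogonal group. -/
theorem eq_top_of_reflectionVectors_eq_univ (h : ∀ v, v ∈ reflectionVectors K) : K = ⊤ := by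
  have hle : Subgroup.closure (Set.range fun v : EuclideanSpace ℝ ι => (ℝ ∙ v)ᗮ.reflection) ≤
      K.comap (orthogonalGroupEquiv ι).symm.toMonoidHom := by
    rw [Subgroup.closure_le]
    rintro _ ⟨v, rfl⟩
    exact h v
  -- Cartan–Dieudonné.
  rw [LinearIsometryEquiv.reflections_generate] at hle
  refine eq_top_iff.2 fun M _ => ?_
  have hM : (orthogonalGroupEquiv ι).symm (orthogonalGroupEquiv ι M) ∈ K :=
    hle (Subgroup.mem_top (orthogonalGroupEquiv ι M))
  rwa [MulEquiv.symm_apply_apply] at hM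

/-- The determinant-one part of a dense subgroup of the orthogonal group is dense. -/
theorem dense_specialOrthogonalGroup (hK : Dense (K : Set (Matrix.orthogonalGroup ι ℝ))) :
    Dense {M : Matrix.specialOrthogonalGroup ι ℝ |
      ∃ V ∈ K, (V : Matrix ι ι ℝ) = (M : Matrix ι ι ℝ)} := by
  rw [dense_iff_inter_open]
  rintro U hU ⟨M, hMU⟩
  obtain ⟨O, hO, rfl⟩ := isOpen_induced_iff.1 hU
  have hMO := M.2
  rw [Matrix.mem_specialOrthogonalGroup_iff] at hMO
  -- The condition `0 < det` is open and, for orthogonal matrices, forces determinant one.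
  have hopen : IsOpen {V : Matrix.orthogonalGroup ι ℝ | V.1 ∈ O ∧ 0 < V.1.det} :=
    (hO.preimage continuous_subtype_val).inter
      (isOpen_lt continuous_const (continuous_subtype_val.matrix_det))
  obtain ⟨V, ⟨hVO, hVdet⟩, hVK⟩ := dense_iff_inter_open.1 hK _ hopen
    ⟨⟨M.1, hMO.1⟩, hMU, by simp [hMO.2]⟩
  have hdet : V.1.det = 1 := by
    have h := congrArg Matrix.det ((Matrix.mem_orthogonalGroup_iff ι ℝ).1 V.2)
    rw [Matrix.det_mul, Matrix.det_transpose, Matrix.det_one] at h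
    nlinarith
  exact ⟨⟨V.1, Matrix.mem_specialOrthogonalGroup_iff.2 ⟨V.2, hdet⟩⟩, hVO, V, hVK, rfl⟩

end

/-! ### The Toffoli and Hadamard gates on three qubits -/

namespace QGate

/-- The vector with integer coordinates `g`. -/
noncomputable def intVec (g : Bits 3 → ℤ) : EuclideanSpace ℝ (Bits 3) :=
  WithLp.toLp 2 fun x => (g x : ℝ)

theorem intVec_add (g h : Bits 3 → ℤ) : intVec (g + h) = intVec g + intVec h := by
  ext x
  simp [intVec]

theorem intVec_sub (g h : Bits 3 → ℤ) : intVec (g - h) = intVec g - intVec h := by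
  ext x
  simp [intVec]

theorem intVec_zsmul (a : ℤ) (g : Bits 3 → ℤ) : intVec (a • g) = (a : ℝ) • intVec g := by
  ext x
  simp [intVec]

theorem inner_intVec (g h : Bits 3 → ℤ) : ⟪intVec g, intVec h⟫ = ((∑ x, h x * g x : ℤ) : ℝ) := by
  simp [intVec, PiLp.inner_apply]

theorem norm_sq_intVec (g : Bits 3 → ℤ) : ‖intVec g‖ ^ 2 = ((∑ x, g x * g x : ℤ) : ℝ) := by
  rw [← real_inner_self_eq_norm_sq, inner_intVec]

/-- The integer coordinates of the computational basis vector labelled `b`. -/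
def basisVec (b x : Bits 3) : ℤ := if x = b then 1 else 0

theorem intVec_basisVec (x : Bits 3) :
    intVec (basisVec x) = (EuclideanSpace.single x 1 : EuclideanSpace ℝ (Bits 3)) := by
  ext y
  simp only [intVec, basisVec, PiLp.single_apply]
  split_ifs <;> simp

/-- `√2` times the Hadamard gate on qubit `i`. -/
def intHadamard (i : Fin 3) (g : Bits 3 → ℤ) (x : Bits 3) : ℤ :=
  ∑ y : Bits 3, (if ∀ j, j ≠ i → x j = y j then (if x i = 1 ∧ y i = 1 then -1 else 1) else 0) * g y

/-- The qubit `i` as an ordered subset of the three qubits. -/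
def oneQubit (i : Fin 3) : Fin 1 ↪ Fin 3 := ⟨fun _ => i, fun _ _ _ => Subsingleton.elim _ _⟩

/-- Membership ignores scaling, so the factor `1/√2` can be dropped and later computations become
decidable identities over `ℤ`. -/
theorem hadamard_on_apply (i : Fin 3) (g : Bits 3 → ℤ) :
    orthogonalGroupEquiv (Bits 3) (hadamard.on (oneQubit i)) (intVec g) =
      (1 / Real.sqrt 2) • intVec (intHadamard i g) := by
  have hH : ∀ a b : Fin 2, hadamardMatrix a b =
      (1 / Real.sqrt 2) * ((if a = 1 ∧ b = 1 then -1 else 1 : ℤ) : ℝ) := by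
    intro a b
    fin_cases a <;> fin_cases b <;> simp [hadamardMatrix]
  have hentry : ∀ x y : Bits 3, (hadamard.on (oneQubit i)).1 x y = (1 / Real.sqrt 2) *
      ((if ∀ j, j ≠ i → x j = y j then (if x i = 1 ∧ y i = 1 then -1 else 1) else 0 : ℤ) : ℝ) := by
    intro x y
    have hr : (∀ j, j ∉ Set.range (oneQubit i) → x j = y j) ↔ ∀ j, j ≠ i → x j = y j := by
      refine forall_congr' fun j => imp_congr_left (not_congr ⟨?_, ?_⟩)
      · rintro ⟨_, rfl⟩
        rfl
      · rintro rfl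
        exact ⟨0, rfl⟩
    change applyOn _ (oneQubit i) x y = _
    unfold applyOn
    rw [Matrix.of_apply]
    by_cases h : ∀ j, j ≠ i → x j = y j
    · rw [if_pos (hr.2 h), if_pos h]
      exact hH _ _
    · rw [if_neg (fun h' => h (hr.1 h')), if_neg h]
      simp
  rw [orthogonalGroupEquiv_apply]
  ext x
  change ∑ y, (hadamard.on (oneQubit i)).1 x y * (g y : ℝ) =
    (1 / Real.sqrt 2) * ((intHadamard i g x : ℤ) : ℝ)
  rw [intHadamard, Int.cast_sum, Finset.mul_sum]
  refine Finset.sum_congr rfl fun y _ => ?_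
  rw [hentry, Int.cast_mul, mul_assoc]

/-- The difference of the two basis vectors that the Toffoli gate with target qubit `i` swaps. -/
def swapDiff (i : Fin 3) (x : Bits 3) : ℤ :=
  if ∀ j, j ≠ i → x j = 1 then (if x i = 1 then 1 else -1) else 0

theorem toffoliMatrix_eq (x y : Bits 3) : toffoliMatrix x y =
    ((if x 0 = y 0 ∧ x 1 = y 1 ∧ ((y 0 = 1 ∧ y 1 = 1) ↔ x 2 ≠ y 2) then 1 else 0 : ℤ) : ℝ) := by
  have hX : ∀ a b : Fin 2, sigmaX a b = if a ≠ b then 1 else 0 := by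
    intro a b
    fin_cases a <;> fin_cases b <;> simp [sigmaX]
  simp only [toffoliMatrix, Matrix.of_apply, hX, Matrix.one_apply]
  by_cases h1 : x 0 = y 0 ∧ x 1 = y 1
  · by_cases h2 : y 0 = 1 ∧ y 1 = 1
    · simp [h1, h2]
    · by_cases h3 : x 2 = y 2 <;> simp [h1, h2, h3]
  · rw [if_neg h1, if_neg (fun h => h1 ⟨h.1, h.2.1⟩), Int.cast_zero]

/-- The three qubits in an order that puts qubit `i` last. -/
def targetLast (i : Fin 3) : Fin 3 ↪ Fin 3 := (Equiv.swap i 2).toEmbedding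

/-- Swapping two orthonormal vectors and fixing their orthogonal complement is the reflection along
their difference. -/
theorem toffoli_on_eq (i : Fin 3) : toffoli.on (targetLast i) =
    (orthogonalGroupEquiv (Bits 3)).symm (ℝ ∙ intVec (swapDiff i))ᗮ.reflection := by
  refine Subtype.ext (Matrix.ext fun x y => ?_)
  have hmem : ∀ j, j ∈ Set.range (targetLast i) := (Equiv.swap i 2).surjective
  have hl : (toffoli.on (targetLast i)).1 x y =
      toffoliMatrix (x ∘ Equiv.swap i 2) (y ∘ Equiv.swap i 2) := by
    change applyOn _ (targetLast i) x y = _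
    unfold applyOn
    rw [Matrix.of_apply, if_pos fun j hj => absurd (hmem j) hj]
    rfl
  have hnorm : ∀ i : Fin 3, ∑ x, swapDiff i x * swapDiff i x = 2 := by decide +kernel
  have hinner : ∑ z : Bits 3, basisVec y z * swapDiff i z = swapDiff i y := by
    simp [basisVec]
  rw [hl, toffoliMatrix_eq, orthogonalGroupEquiv_symm_apply,
    reflection_span_singleton_orthogonal_apply, ← intVec_basisVec, inner_intVec, norm_sq_intVec,
    hnorm, hinner]
  have key : ∀ (i : Fin 3) (x y : Bits 3),
      (if (x ∘ Equiv.swap i 2) 0 = (y ∘ Equiv.swap i 2) 0 ∧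
        (x ∘ Equiv.swap i 2) 1 = (y ∘ Equiv.swap i 2) 1 ∧
        (((y ∘ Equiv.swap i 2) 0 = 1 ∧ (y ∘ Equiv.swap i 2) 1 = 1) ↔
          (x ∘ Equiv.swap i 2) 2 ≠ (y ∘ Equiv.swap i 2) 2) then 1 else 0 : ℤ) =
      basisVec y x - swapDiff i y * swapDiff i x := by
    decide +kernel
  rw [key i x y]
  change _ = ((basisVec y x : ℤ) : ℝ) -
    (2 * ((swapDiff i y : ℝ) / ((2 : ℤ) : ℝ))) * (swapDiff i x : ℝ)
  push_cast
  ring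

/-- Doubling the angle makes the cosine rational, namely `2/8 - 1 = -3/4`, a value that Niven's
theorem excludes. -/
theorem neg_one_div_sqrt_eight_notMem : -1 / Real.sqrt 8 ∉ rationalAngleCosines := by
  rintro ⟨r, hr⟩
  have h8 : Real.cos (r * Real.pi) ^ 2 = 1 / 8 := by
    simp only at hr
    rw [hr, div_pow, Real.sq_sqrt (by norm_num)]
    norm_num
  have h2 : Real.cos (2 * (r * Real.pi)) = -3 / 4 := by
    rw [Real.cos_two_mul, h8]
    norm_num
  have h := niven (θ := 2 * (r * Real.pi)) ⟨2 * r, by push_cast; ring⟩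
    ⟨-3 / 4, by rw [h2]; norm_num⟩
  rw [h2] at h
  simp only [Set.mem_insert_iff, Set.mem_singleton_iff] at h
  norm_num at h

/-- The coordinates, up to scaling, of the image of `|111⟩` under the Hadamard gates on all three
qubits. -/
def signVec (x : Bits 3) : ℤ := ∏ i, if x i = 1 then -1 else 1

/-- The coordinates, up to scaling, of the image of `|111⟩` under the Hadamard gates on the qubits
other than `i`. -/
def partialSignVec (i : Fin 3) (x : Bits 3) : ℤ :=
  if x i = 1 then -signVec x else 0

theorem reflectionVectors_eq_univ {K : Subgroup (Matrix.orthogonalGroup (Bits 3) ℝ)}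
    (hK : IsClosed (K : Set (Matrix.orthogonalGroup (Bits 3) ℝ)))
    (hG : generated {toffoli, hadamard} 3 ≤ K) (v : EuclideanSpace ℝ (Bits 3)) :
    v ∈ reflectionVectors K := by
  have hΦ := isReflectionClosed_reflectionVectors hK
  have hhad : ∀ i g, intVec g ∈ reflectionVectors K →
      intVec (intHadamard i g) ∈ reflectionVectors K := by
    intro i g hg
    have hmem : hadamard.on (oneQubit i) ∈ K :=
      hG (Subgroup.subset_closure ⟨hadamard, by simp, oneQubit i, rfl⟩)
    have h := map_mem_reflectionVectors hmem hg
    rw [hadamard_on_apply] at h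
    exact hΦ.mem_of_smul_mem (by positivity) h
  have hdiff : ∀ i, intVec (swapDiff i) ∈ reflectionVectors K := by
    intro i
    have hmem : toffoli.on (targetLast i) ∈ K :=
      hG (Subgroup.subset_closure ⟨toffoli, by simp, targetLast i, rfl⟩)
    rw [toffoli_on_eq] at hmem
    exact hmem
  set e : Bits 3 → ℤ := basisVec (fun _ => 1) with he
  -- A Hadamard on the target qubit turns `|111⟩ - |110⟩` into a multiple of `|111⟩`.
  have hediff : intHadamard 2 (swapDiff 2) = (-2 : ℤ) • e := by
    funext x
    revert x
    decide +kernel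
  have heΦ : intVec e ∈ reflectionVectors K := by
    have h := hhad 2 _ (hdiff 2)
    rw [hediff, intVec_zsmul] at h
    exact hΦ.mem_of_smul_mem (by norm_num) h
  have hsign : intHadamard 0 (intHadamard 1 (intHadamard 2 e)) = signVec := by
    funext x
    revert x
    decide +kernel
  have hpartial : ∀ i : Fin 3,
      intHadamard (i + 1) (intHadamard (i + 2) e) = partialSignVec i := by
    intro i
    funext x
    revert i x
    decide +kernel
  have hsignΦ : intVec signVec ∈ reflectionVectors K := hsign ▸ hhad _ _ (hhad _ _ (hhad _ _ heΦ))
  have hpartialΦ : ∀ i, intVec (partialSignVec i) ∈ reflectionVectors K := fun i =>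
    hpartial i ▸ hhad _ _ (hhad _ _ heΦ)
  have hsum1 : ∑ x, e x * e x = 1 := by decide +kernel
  have hsum8 : ∑ x, signVec x * signVec x = 8 := by decide +kernel
  have hsum : ∑ x, signVec x * e x = -1 := by decide +kernel
  have hnorm1 : ‖intVec e‖ = 1 := by
    have h := norm_sq_intVec e
    rw [hsum1, Int.cast_one] at h
    exact (pow_eq_one_iff_of_nonneg (norm_nonneg _) two_ne_zero).1 h
  have hnorm8 : ‖intVec signVec‖ = Real.sqrt 8 := by
    have h := norm_sq_intVec signVec
    rw [hsum8] at h
    rw [← Real.sqrt_sq (norm_nonneg (intVec signVec)), h]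
    norm_num
  have hs8 : Real.sqrt 8 ≠ 0 := by positivity
  obtain ⟨W, heW, hsW, hW, hdich⟩ := hΦ.exists_submodule heΦ
    (hΦ.smul_mem (Real.sqrt 8)⁻¹ hsignΦ) hnorm1
    (by rw [norm_smul, hnorm8, norm_inv, Real.norm_of_nonneg (Real.sqrt_nonneg 8),
      inv_mul_cancel₀ hs8])
    (by
      rw [real_inner_smul_right, inner_intVec, hsum]
      convert neg_one_div_sqrt_eight_notMem using 1
      push_cast
      rw [div_eq_inv_mul])
  have hsignW : intVec signVec ∈ W := by
    simpa [smul_smul, hs8] using W.smul_mem (Real.sqrt 8) hsW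
  -- Since `e` lies in `W`, a member not orthogonal to `e` cannot lie in `Wᗮ`.
  have hmemW : ∀ g : Bits 3 → ℤ, intVec g ∈ reflectionVectors K → ∑ x, g x * e x ≠ 0 →
      intVec g ∈ W := by
    intro g hg hne
    refine (hdich _ hg).resolve_right fun h => hne ?_
    have h0 := (Submodule.mem_orthogonal W _).1 h _ heW
    rw [inner_intVec] at h0
    exact_mod_cast h0
  have hdne : ∀ i, ∑ x, swapDiff i x * e x ≠ 0 := by decide +kernel
  have hpne : ∀ i, ∑ x, partialSignVec i x * e x ≠ 0 := by decide +kernel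
  have hdW : ∀ i, intVec (swapDiff i) ∈ W := fun i => hmemW _ (hdiff i) (hdne i)
  have hpW : ∀ i, intVec (partialSignVec i) ∈ W := fun i => hmemW _ (hpartialΦ i) (hpne i)
  have hzero : intVec (basisVec fun _ => 1) ∈ W := heW
  have htwo : ∀ i, intVec (basisVec fun j => if j = i then 0 else 1) ∈ W := by
    intro i
    have h : ∀ i, basisVec (fun j => if j = i then 0 else 1) = e - swapDiff i := by
      intro i
      funext x
      revert i x
      decide +kernel
    rw [h, intVec_sub]
    exact W.sub_mem heW (hdW i)
  -- The support of `partialSignVec i` is the face `x i = 1`, whose only label of weight below two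
  -- is the one sought.
  have hone : ∀ i, intVec (basisVec fun j => if j = i then 1 else 0) ∈ W := by
    intro i
    have h : ∀ i : Fin 3, basisVec (fun j => if j = i then 1 else 0) = partialSignVec i +
        basisVec (fun j => if j = i + 1 then 0 else 1) +
        basisVec (fun j => if j = i + 2 then 0 else 1) - e := by
      intro i
      funext x
      revert i x
      decide +kernel
    rw [h, intVec_sub, intVec_add, intVec_add]
    exact W.sub_mem (W.add_mem (W.add_mem (hpW i) (htwo _)) (htwo _)) heW
  -- All coordinates of `signVec` are `±1`; the other seven basis vectors are already in `W`.
  have hnone : intVec (basisVec fun _ => 0) ∈ W := by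
    have h : basisVec (fun _ => 0) = signVec +
        basisVec (fun j => if j = 0 then 1 else 0) + basisVec (fun j => if j = 1 then 1 else 0) +
        basisVec (fun j => if j = 2 then 1 else 0) -
        basisVec (fun j => if j = 0 then 0 else 1) - basisVec (fun j => if j = 1 then 0 else 1) -
        basisVec (fun j => if j = 2 then 0 else 1) + e := by
      funext x
      revert x
      decide +kernel
    rw [h, intVec_add, intVec_sub, intVec_sub, intVec_sub, intVec_add, intVec_add, intVec_add]
    exact W.add_mem (W.sub_mem (W.sub_mem (W.sub_mem (W.add_mem (W.add_mem (W.add_mem hsignW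
      (hone 0)) (hone 1)) (hone 2)) (htwo 0)) (htwo 1)) (htwo 2)) heW
  have hcases : ∀ x : Bits 3, x = (fun _ => 0) ∨ x = (fun _ => 1) ∨
      (∃ i, x = fun j => if j = i then 1 else 0) ∨ ∃ i, x = fun j => if j = i then 0 else 1 := by
    decide +kernel
  have hall : ∀ x, (EuclideanSpace.single x 1 : EuclideanSpace ℝ (Bits 3)) ∈ W := by
    intro x
    rw [← intVec_basisVec]
    rcases hcases x with rfl | rfl | ⟨i, rfl⟩ | ⟨i, rfl⟩
    exacts [hnone, hzero, hone i, htwo i]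
  have hv : v = ∑ x, v x • (EuclideanSpace.single x 1 : EuclideanSpace ℝ (Bits 3)) := by
    ext y
    simp [Pi.single_apply]
  exact hW (hv ▸ W.sum_mem fun x _ => W.smul_mem _ (hall x))

/-- The Toffoli and Hadamard gates generate a dense subgroup of `O(8)`. -/
theorem dense_generated_toffoli_hadamard : Dense
    (generated {toffoli, hadamard} 3 : Set (Matrix.orthogonalGroup (Bits 3) ℝ)) := by
  have htop : (generated {toffoli, hadamard} 3).topologicalClosure = ⊤ :=
    eq_top_of_reflectionVectors_eq_univ
      (reflectionVectors_eq_univ (Subgroup.isClosed_topologicalClosure _)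
        (Subgroup.le_topologicalClosure _))
  intro M
  have hM : M ∈ (generated {toffoli, hadamard} 3).topologicalClosure := htop ▸ Subgroup.mem_top M
  exact hM

end QGate

theorem theorem4 :
    QGate.IsComplete {QGate.toffoli, QGate.hadamard} ∧
    Dense (QGate.generated {QGate.toffoli, QGate.hadamard} 3 :
      Set (Matrix.orthogonalGroup (QGate.Bits 3) ℝ)) ∧
    Dense {M : Matrix.specialOrthogonalGroup (QGate.Bits 3) ℝ |
      ∃ V ∈ QGate.generated {QGate.toffoli, QGate.hadamard} 3,
        (V : Matrix (QGate.Bits 3) (QGate.Bits 3) ℝ) =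
          (M : Matrix (QGate.Bits 3) (QGate.Bits 3) ℝ)} :=
  ⟨⟨3, by norm_num, QGate.dense_generated_toffoli_hadamard⟩,
    QGate.dense_generated_toffoli_hadamard,
    dense_specialOrthogonalGroup QGate.dense_generated_toffoli_hadamard⟩
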